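/- Let $(X,d,\mu)$ be a metric measure space: $(X,d)$ is a compact metric space and $\mu$ is a Borel probability measure on $X$. Put $$K_A(x,s)=-\tfrac12 d(x,s)^2,$$ $$K_B(x,s)=K_A(x,s)-\int_X K_A(w,s)\,\mu(dw)-\int_X K_A(x,z)\,\mu(dz)+\int_X\int_X K_A(w,z)\,\mu(dw)\,\mu(dz),$$ and let $T_{K_B}\colon L^2(X,\mu)\to L^2(X,\mu)$ be the bounded operator on the real Hilbert space $L^2(X,\mu)$ given by $[T_{K_B}\phi](x)=\int_X K_B(x,s)\phi(s)\,\mu(ds)$. Call $X$ Euclidean if there is an isometric (that is, distance-preserving) map $X\to\ell^2$. A bounded self-adjoint operator $T$ on a Hilbert space is positive semi-definite if $\langle T\phi,\phi\rangle\ge 0$ for all $\phi$. **Theorem.** If $X$ is Euclidean, then $T_{K_B}$ is a positive semi-definite operator on $L^2(X,\mu)$. If moreover $\mu$ has full support, $\operatorname{supp}\mu=X$, then the converse holds too: $X$ is Euclidean if and only if $T_{K_B}$ is positive semi-definite. -/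

import Mathlib

open MeasureTheory
open scoped ENNReal

noncomputable section

namespace InfiniteMDS

section IntegralOperator

variable {X : Type*} [MeasurableSpace X]

/-- The function `x ↦ ∫ K(x,s) φ(s) μ(ds)`. -/
def kernelIntegral (μ : Measure X) (K : X → X → ℝ) (φ : X → ℝ) (x : X) : ℝ :=
  ∫ s, K x s * φ s ∂μ

variable {μ : Measure X} [SFinite μ] {K : X → X → ℝ}

theorem ae_memLp_section (hK : MemLp (Function.uncurry K) 2 (μ.prod μ)) :
    ∀ᵐ x ∂μ, MemLp (K x) 2 μ := by
  have h1 : ∀ᵐ x ∂μ, AEStronglyMeasurable (K x) μ := hK.1.prodMk_left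
  have hfin : ∫⁻ z, ‖Function.uncurry K z‖ₑ ^ (2 : ℝ) ∂(μ.prod μ) < ∞ := by
    simpa using lintegral_rpow_enorm_lt_top_of_eLpNorm_lt_top (by simp) (by simp) hK.2
  have hm : AEMeasurable (fun z => ‖Function.uncurry K z‖ₑ ^ (2 : ℝ)) (μ.prod μ) :=
    hK.1.enorm.pow_const _
  rw [lintegral_prod _ hm] at hfin
  have h2 := ae_lt_top' hm.lintegral_prod_right' hfin.ne
  filter_upwards [h1, h2] with x hx1 hx2
  refine ⟨hx1, ?_⟩
  rw [eLpNorm_lt_top_iff_lintegral_rpow_enorm_lt_top (by simp) (by simp)]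
  simpa using hx2

theorem ae_integrable_section (hK : MemLp (Function.uncurry K) 2 (μ.prod μ))
    {φ : X → ℝ} (hφ : MemLp φ 2 μ) :
    ∀ᵐ x ∂μ, Integrable (fun s => K x s * φ s) μ := by
  filter_upwards [ae_memLp_section hK] with x hx
  exact hx.integrable_mul hφ

theorem aestronglyMeasurable_kernelIntegral
    (hK : MemLp (Function.uncurry K) 2 (μ.prod μ)) {φ : X → ℝ} (hφ : MemLp φ 2 μ) :
    AEStronglyMeasurable (kernelIntegral μ K φ) μ :=
  AEStronglyMeasurable.integral_prod_right' (f := fun z : X × X => K z.1 z.2 * φ z.2)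
    (hK.1.mul hφ.1.comp_snd)

theorem eLpNorm_kernelIntegral_le
    (hK : MemLp (Function.uncurry K) 2 (μ.prod μ)) {φ : X → ℝ} (hφ : MemLp φ 2 μ) :
    eLpNorm (kernelIntegral μ K φ) 2 μ ≤
      eLpNorm (Function.uncurry K) 2 (μ.prod μ) * eLpNorm φ 2 μ := by
  have hm : AEMeasurable (fun z => ‖Function.uncurry K z‖ₑ ^ (2 : ℝ)) (μ.prod μ) :=
    hK.1.enorm.pow_const _
  simp only [eLpNorm_eq_lintegral_rpow_enorm_toReal (p := 2) (by simp) (by simp),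
    ENNReal.toReal_ofNat]
  rw [← ENNReal.mul_rpow_of_nonneg _ _ (by norm_num)]
  refine ENNReal.rpow_le_rpow ?_ (by norm_num)
  rw [lintegral_prod _ hm, ← lintegral_mul_const'' _ hm.lintegral_prod_right']
  refine lintegral_mono_ae ?_
  filter_upwards [ae_memLp_section hK] with x hx
  have h := ENNReal.lintegral_mul_le_Lp_mul_Lq μ Real.HolderConjugate.two_two
    hx.1.enorm hφ.1.enorm
  rw [← ENNReal.mul_rpow_of_nonneg _ _ (by norm_num)] at h
  have h0 : ‖kernelIntegral μ K φ x‖ₑ ≤ ∫⁻ s, ‖K x s‖ₑ * ‖φ s‖ₑ ∂μ := by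
    refine (enorm_integral_le_lintegral_enorm _).trans_eq ?_
    simp only [enorm_mul]
  have h3 := ENNReal.rpow_le_rpow (h0.trans h) (z := (2 : ℝ)) (by norm_num)
  rw [← ENNReal.rpow_mul] at h3
  simpa using h3

theorem memLp_kernelIntegral
    (hK : MemLp (Function.uncurry K) 2 (μ.prod μ)) {φ : X → ℝ} (hφ : MemLp φ 2 μ) :
    MemLp (kernelIntegral μ K φ) 2 μ :=
  ⟨aestronglyMeasurable_kernelIntegral hK hφ,
    (eLpNorm_kernelIntegral_le hK hφ).trans_lt (ENNReal.mul_lt_top hK.2 hφ.2)⟩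

theorem norm_toLp_kernelIntegral_le
    (hK : MemLp (Function.uncurry K) 2 (μ.prod μ)) (φ : Lp ℝ 2 μ) :
    ‖(memLp_kernelIntegral hK (Lp.memLp φ)).toLp (kernelIntegral μ K φ)‖ ≤
      (eLpNorm (Function.uncurry K) 2 (μ.prod μ)).toReal * ‖φ‖ := by
  rw [Lp.norm_toLp, Lp.norm_def, ← ENNReal.toReal_mul]
  exact ENNReal.toReal_mono (ENNReal.mul_lt_top hK.2 (Lp.memLp φ).2).ne
    (eLpNorm_kernelIntegral_le hK (Lp.memLp φ))

/-- The Hilbert-Schmidt integral operator `[T_K φ](x) = ∫ K(x,s) φ(s) μ(ds)` on `L²(X, μ)`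
of a square-integrable kernel `K`. -/
def integralOperator (μ : Measure X) [SFinite μ] (K : X → X → ℝ)
    (hK : MemLp (Function.uncurry K) 2 (μ.prod μ)) : Lp ℝ 2 μ →L[ℝ] Lp ℝ 2 μ :=
  LinearMap.mkContinuous
    { toFun := fun φ => (memLp_kernelIntegral hK (Lp.memLp φ)).toLp (kernelIntegral μ K φ)
      map_add' := fun φ ψ => by
        rw [← MemLp.toLp_add, MemLp.toLp_eq_toLp_iff]
        filter_upwards [ae_integrable_section hK (Lp.memLp φ),
          ae_integrable_section hK (Lp.memLp ψ)] with x h1 h2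
        simp only [kernelIntegral, Pi.add_apply]
        rw [← integral_add h1 h2]
        refine integral_congr_ae ?_
        filter_upwards [Lp.coeFn_add φ ψ] with s hs
        rw [hs, Pi.add_apply, mul_add]
      map_smul' := fun c φ => by
        rw [RingHom.id_apply, ← MemLp.toLp_const_smul, MemLp.toLp_eq_toLp_iff]
        refine Filter.Eventually.of_forall fun x => ?_
        simp only [kernelIntegral, Pi.smul_apply, smul_eq_mul]
        rw [← integral_const_mul]
        refine integral_congr_ae ?_
        filter_upwards [Lp.coeFn_smul c φ] with s hs
        rw [hs, Pi.smul_apply, smul_eq_mul, mul_left_comm] }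
    (eLpNorm (Function.uncurry K) 2 (μ.prod μ)).toReal
    (fun φ => norm_toLp_kernelIntegral_le hK φ)

theorem integralOperator_coeFn (hK : MemLp (Function.uncurry K) 2 (μ.prod μ))
    (φ : Lp ℝ 2 μ) :
    integralOperator μ K hK φ =ᵐ[μ] fun x => ∫ s, K x s * φ s ∂μ :=
  MemLp.coeFn_toLp (memLp_kernelIntegral hK (Lp.memLp φ))

end IntegralOperator

section MDS

variable {X : Type*} [MetricSpace X]

/-- `X` is Euclidean if it embeds isometrically into the real Hilbert space `ℓ²`. -/
def IsEuclidean (X : Type*) [MetricSpace X] : Prop :=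
  ∃ f : X → lp (fun _ : ℕ => ℝ) 2, Isometry f

/-- `K_A(x,s) = -d(x,s)² / 2`. -/
def kernelA (x s : X) : ℝ := -(1 / 2) * dist x s ^ 2

variable [MeasurableSpace X]

/-- The double centering `K_B` of `K_A` with respect to `μ`. -/
def kernelB (μ : Measure X) (x s : X) : ℝ :=
  kernelA x s - (∫ w, kernelA w s ∂μ) - (∫ z, kernelA x z ∂μ)
    + ∫ z, ∫ w, kernelA w z ∂μ ∂μ

variable [CompactSpace X] [BorelSpace X]

theorem continuous_kernelB (μ : Measure X) [IsFiniteMeasure μ] :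
    Continuous (Function.uncurry (kernelB μ)) := by
  have hA : Continuous fun p : X × X => kernelA p.1 p.2 := by
    unfold kernelA; fun_prop
  have h1 : Continuous fun s : X => ∫ w, kernelA w s ∂μ := by
    have := continuous_parametric_integral_of_continuous (μ := μ)
      (f := fun s w : X => kernelA w s) (hA.comp continuous_swap) isCompact_univ
    simpa using this
  have h2 : Continuous fun x : X => ∫ z, kernelA x z ∂μ := by
    have := continuous_parametric_integral_of_continuous (μ := μ)
      (f := fun x z : X => kernelA x z) hA isCompact_univ
    simpa using this
  exact ((hA.sub (h1.comp continuous_snd)).sub (h2.comp continuous_fst)).add continuous_const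

theorem memLp_kernelB (μ : Measure X) [IsFiniteMeasure μ] :
    MemLp (Function.uncurry (kernelB μ)) 2 (μ.prod μ) := by
  have hc := continuous_kernelB μ
  obtain ⟨C, hC⟩ := isCompact_univ.exists_bound_of_continuousOn hc.continuousOn
  exact MemLp.of_bound hc.aestronglyMeasurable C
    (Filter.Eventually.of_forall fun z => hC z (Set.mem_univ z))

/-- The operator `T_{K_B}` on `L²(X, μ)`. -/
def operatorTB (μ : Measure X) [IsFiniteMeasure μ] : Lp ℝ 2 μ →L[ℝ] Lp ℝ 2 μ :=
  integralOperator μ (kernelB μ) (memLp_kernelB μ)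

end MDS

end InfiniteMDS

end

/-!
Both directions go through Gram kernels `⟪g x, g s⟫` of maps `g` into a Hilbert space.

If `f : X → ℓ²` is an isometry with mean `m = ∫ f dμ`, polarization and double centering give
`K_B(x,s) = ⟪f x - m, f s - m⟫` (`kernelB_eq_inner_of_isometry`). The quadratic form of the
integral operator of a Gram kernel is `⟪T φ, φ⟫ = ‖∫ φ g dμ‖² ≥ 0`
(`isPositive_integralOperator_of_inner`).

Conversely, suppose that `T` is positive and that `μ` charges every nonempty open set. The
normalized indicators of small balls are approximate point masses: as the radius tends to `0`,
`⟪T φ, φ⟫` at a finite combination of them tends to the corresponding finite quadratic form of the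
continuous kernel `K_B`, which is therefore nonnegative (`sum_kernel_nonneg_of_isPositive`). The
reproducing kernel Hilbert space of `K_B` yields `F : X → H` with `⟪F x, F s⟫ = K_B(x,s)`
(`exists_featureMap`). Since `K_B(x,x) - 2 K_B(x,s) + K_B(s,s) = d(x,s)²`, the map `F` is an
isometry. As `X` is separable, so is the closed span of its image, which therefore embeds
linearly and isometrically into `ℓ²` (`IsEuclidean.of_isometry`).
-/

open Filter Topology
open scoped RealInnerProductSpace

noncomputable section

namespace InfiniteMDS

/-! ### Separable Hilbert spaces embed into `ℓ²` -/

section Separable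

/-- Distinct members of an orthonormal family are at distance `√2`, so the balls of radius `1 / 2`
around them are disjoint. -/
theorem countable_of_orthonormal {E ι : Type*} [NormedAddCommGroup E] [InnerProductSpace ℝ E]
    [TopologicalSpace.SeparableSpace E] {v : ι → E} (hv : Orthonormal ℝ v) : Countable ι := by
  have hd : ∀ i j, i ≠ j → (1 : ℝ) ≤ dist (v i) (v j) := by
    intro i j hij
    have h := norm_sub_sq_real (v i) (v j)
    rw [hv.1 i, hv.1 j, hv.2 hij] at h
    rw [dist_eq_norm]
    nlinarith [norm_nonneg (v i - v j)]
  have hdisj : Pairwise (Function.onFun Disjoint fun i => Metric.ball (v i) (1 / 2)) := by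
    intro i j hij
    exact Metric.ball_disjoint_ball (by linarith [hd i j hij])
  exact Pairwise.countable_of_isOpen_disjoint hdisj (fun _ => Metric.isOpen_ball)
    fun i => ⟨v i, Metric.mem_ball_self (by norm_num)⟩

theorem nonempty_linearIsometry_l2 (E : Type*) [NormedAddCommGroup E] [InnerProductSpace ℝ E]
    [CompleteSpace E] [TopologicalSpace.SeparableSpace E] :
    Nonempty (E →ₗᵢ[ℝ] lp (fun _ : ℕ => ℝ) 2) := by
  obtain ⟨w, b, -⟩ := exists_hilbertBasis ℝ E
  have : Countable w := countable_of_orthonormal b.orthonormal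
  obtain ⟨e, he⟩ := exists_injective_nat w
  let b₀ : HilbertBasis ℕ ℝ (lp (fun _ : ℕ => ℝ) 2) :=
    HilbertBasis.ofRepr (LinearIsometryEquiv.refl ℝ _)
  have ho : Orthonormal ℝ (b₀ ∘ e) := b₀.orthonormal.comp e he
  exact ⟨ho.orthogonalFamily.linearIsometry.comp b.repr.toLinearIsometry⟩

/-- Only the closed linear span of the image matters, and it is separable. -/
theorem IsEuclidean.of_isometry {X E : Type*} [MetricSpace X] [TopologicalSpace.SeparableSpace X]
    [NormedAddCommGroup E] [InnerProductSpace ℝ E] [CompleteSpace E] {f : X → E}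
    (hf : Isometry f) : IsEuclidean X := by
  let S : Submodule ℝ E := (Submodule.span ℝ (Set.range f)).topologicalClosure
  have hfS : ∀ x, f x ∈ S := fun x =>
    Submodule.le_topologicalClosure _ (Submodule.subset_span ⟨x, rfl⟩)
  have hsep : TopologicalSpace.IsSeparable (S : Set E) :=
    ((TopologicalSpace.isSeparable_range hf.continuous).span (R := ℝ)).closure
  have : TopologicalSpace.SeparableSpace S := hsep.separableSpace
  have : CompleteSpace S :=
    (Submodule.isClosed_topologicalClosure _).isComplete.completeSpace_coe
  obtain ⟨L⟩ := nonempty_linearIsometry_l2 S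
  exact ⟨fun x => L ⟨f x, hfS x⟩, L.isometry.comp fun x y => hf x y⟩

end Separable

/-! ### Feature maps of positive semidefinite kernels -/

section PosSemidefKernel

/-- The feature map of a positive semidefinite kernel: its canonical map into the reproducing
kernel Hilbert space. -/
theorem exists_featureMap.{u} {X : Type u} (K : X → X → ℝ) (hsymm : ∀ x y, K x y = K y x)
    (hpos : ∀ c : X →₀ ℝ, 0 ≤ c.sum fun x a => c.sum fun y b => a * b * K x y) :
    ∃ (H : Type u) (_ : NormedAddCommGroup H) (_ : InnerProductSpace ℝ H) (_ : CompleteSpace H)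
      (F : X → H), ∀ x y, ⟪F x, F y⟫ = K x y := by
  let M : Matrix X X (ℝ →L[ℝ] ℝ) := Matrix.of fun x y => K x y • (1 : ℝ →L[ℝ] ℝ)
  have hM : M.PosSemidef := by
    have h := (RKHS.posSemidef_tfae (K := M)).out 0 2
    refine h.mpr ⟨?_, fun c => ?_⟩
    · ext x y
      simp [M, Matrix.conjTranspose_apply, hsymm x y]
    · refine (hpos c).trans_eq ?_
      simp only [M, Matrix.of_apply, FunLike.coe_smul, Pi.smul_apply, RCLike.re_to_real]
      refine Finsupp.sum_congr fun x _ => Finsupp.sum_congr fun y _ => ?_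
      simp [hsymm x y]
      ring
  have : Fact M.PosSemidef := ⟨hM⟩
  refine ⟨RKHS.OfKernel M, inferInstance, inferInstance, inferInstance,
    fun x => RKHS.kerFun (RKHS.OfKernel M) x (1 : ℝ), fun x y => ?_⟩
  rw [← RKHS.kernel_inner, RKHS.OfKernel.kernel_ofKernel]
  simp [M, hsymm x y]

end PosSemidefKernel

/-! ### Positivity of integral operators -/

section IntegralOperator

variable {X : Type*} [MeasurableSpace X] {μ : Measure X}

theorem inner_integralOperator [SFinite μ] {K : X → X → ℝ}
    (hK : MemLp (Function.uncurry K) 2 (μ.prod μ)) (φ ψ : Lp ℝ 2 μ) :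
    ⟪integralOperator μ K hK φ, ψ⟫ = ∫ x, ψ x * ∫ s, K x s * φ s ∂μ ∂μ := by
  rw [L2.inner_def]
  refine integral_congr_ae ?_
  filter_upwards [integralOperator_coeFn hK φ] with x hx
  rw [hx]
  rfl

/-- A kernel that is a Gram matrix `⟪g x, g s⟫` gives a positive operator, because the quadratic
form at `φ` is `‖∫ φ g‖²`. -/
theorem isPositive_integralOperator_of_inner [IsFiniteMeasure μ] {K : X → X → ℝ}
    (hK : MemLp (Function.uncurry K) 2 (μ.prod μ))
    {H : Type*} [NormedAddCommGroup H] [InnerProductSpace ℝ H] [CompleteSpace H]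
    {g : X → H} (hg : MemLp g 2 μ) (hKg : ∀ x s, K x s = ⟪g x, g s⟫) :
    (integralOperator μ K hK).IsPositive := by
  have hint : ∀ φ : Lp ℝ 2 μ, Integrable (fun s => φ s • g s) μ := fun φ =>
    memLp_one_iff_integrable.mp (hg.smul (Lp.memLp φ))
  have key : ∀ φ ψ : Lp ℝ 2 μ, ⟪integralOperator μ K hK φ, ψ⟫ =
      ⟪∫ s, φ s • g s ∂μ, ∫ s, ψ s • g s ∂μ⟫ := by
    intro φ ψ
    rw [inner_integralOperator, ← integral_inner (hint ψ)]
    refine integral_congr_ae (Eventually.of_forall fun x => ?_)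
    simp only
    rw [real_inner_smul_right, real_inner_comm, ← integral_inner (hint φ)]
    congr 1
    refine integral_congr_ae (Eventually.of_forall fun s => ?_)
    simp only
    rw [hKg, real_inner_smul_right, mul_comm]
  refine (ContinuousLinearMap.isPositive_iff _).mpr ⟨fun φ ψ => ?_, fun φ => ?_⟩
  · change ⟪integralOperator μ K hK φ, ψ⟫ = ⟪φ, integralOperator μ K hK ψ⟫
    rw [real_inner_comm _ φ, key, key, real_inner_comm]
  · rw [key]
    exact real_inner_self_nonneg

/-- The normalized indicator `1_A / μ(A)` as an element of `L²`; it is `0` if `μ(A) = 0`. -/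
def averagingLp (μ : Measure X) [IsFiniteMeasure μ] {A : Set X} (hA : MeasurableSet A) :
    Lp ℝ 2 μ :=
  indicatorConstLp 2 hA (measure_ne_top μ A) (μ.real A)⁻¹

theorem integral_averagingLp_mul [IsFiniteMeasure μ] {A : Set X} (hA : MeasurableSet A)
    (f : X → ℝ) : ∫ x, averagingLp μ hA x * f x ∂μ = ⨍ x in A, f x ∂μ := by
  rw [setAverage_eq, ← integral_smul, ← integral_indicator hA]
  refine integral_congr_ae ?_
  filter_upwards [indicatorConstLp_coeFn (p := 2) (hs := hA) (hμs := measure_ne_top μ A)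
    (c := (μ.real A)⁻¹)] with x hx
  rw [averagingLp, hx]
  by_cases h : x ∈ A <;> simp [h]

theorem inner_integralOperator_averagingLp [IsFiniteMeasure μ] {K : X → X → ℝ}
    (hK : MemLp (Function.uncurry K) 2 (μ.prod μ)) {A B : Set X} (hA : MeasurableSet A)
    (hB : MeasurableSet B) :
    ⟪integralOperator μ K hK (averagingLp μ hB), averagingLp μ hA⟫ =
      ⨍ x in A, ⨍ s in B, K x s ∂μ ∂μ := by
  rw [inner_integralOperator, integral_averagingLp_mul]
  simp_rw [mul_comm (K _ _), integral_averagingLp_mul]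

variable [MetricSpace X] [CompactSpace X] [BorelSpace X]

/-- If `K` differs from `K x y` by at most `ε` on the product of two balls, then so do its iterated
averages, because closed balls of `ℝ` are convex and closed. -/
theorem tendsto_average_ball [IsFiniteMeasure μ] [μ.IsOpenPosMeasure] {K : X → X → ℝ}
    (hK : Continuous (Function.uncurry K)) (x y : X) :
    Tendsto (fun r : ℝ => ⨍ a in Metric.ball x r, ⨍ s in Metric.ball y r, K a s ∂μ ∂μ)
      (𝓝[>] 0) (𝓝 (K x y)) := by
  have hint : ∀ {f : X → ℝ} (A : Set X), Continuous f → IntegrableOn f A μ := fun A hf =>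
    (hf.integrable_of_hasCompactSupport (HasCompactSupport.of_compactSpace _)).integrableOn
  rw [Metric.nhds_basis_closedBall.tendsto_right_iff]
  intro ε hε
  obtain ⟨δ, hδ, hKδ⟩ := Metric.continuousAt_iff.mp (hK.continuousAt (x := (x, y))) ε hε
  filter_upwards [Ioo_mem_nhdsGT hδ] with r hr
  have h0 : ∀ z : X, μ (Metric.ball z r) ≠ 0 := fun z =>
    (Metric.measure_ball_pos μ z hr.1).ne'
  have hcont : Continuous fun a => ⨍ s in Metric.ball y r, K a s ∂μ := by
    simp_rw [setAverage_eq]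
    have h : Continuous fun a => ∫ s in Metric.ball y r, K a s ∂μ := by
      have := continuous_parametric_integral_of_continuous (μ := μ.restrict (Metric.ball y r))
        hK isCompact_univ
      simpa using this
    exact h.const_smul (μ.real (Metric.ball y r))⁻¹
  refine (convex_closedBall (K x y) ε).set_average_mem Metric.isClosed_closedBall (h0 x)
    (measure_ne_top _ _) ?_ (hint _ hcont)
  filter_upwards [ae_restrict_mem Metric.isOpen_ball.measurableSet] with a ha
  refine (convex_closedBall (K x y) ε).set_average_mem Metric.isClosed_closedBall (h0 y)
    (measure_ne_top _ _) ?_ (hint _ (hK.comp (Continuous.prodMk_right a)))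
  filter_upwards [ae_restrict_mem Metric.isOpen_ball.measurableSet] with s hs
  refine (hKδ (x := (a, s)) ?_).le
  rw [Prod.dist_eq]
  exact max_lt (lt_trans ha hr.2) (lt_trans hs hr.2)

/-- The quadratic form of the operator at a combination of averages over small balls tends to the
quadratic form of the kernel at the centres. -/
theorem sum_kernel_nonneg_of_isPositive [IsFiniteMeasure μ] [μ.IsOpenPosMeasure] {K : X → X → ℝ}
    (hK : MemLp (Function.uncurry K) 2 (μ.prod μ)) (hKc : Continuous (Function.uncurry K))
    (hpos : (integralOperator μ K hK).IsPositive) (c : X →₀ ℝ) :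
    0 ≤ c.sum fun x a => c.sum fun y b => a * b * K x y := by
  have hlim : Tendsto (fun r : ℝ => c.sum fun x a => c.sum fun y b =>
      a * b * ⨍ z in Metric.ball x r, ⨍ s in Metric.ball y r, K z s ∂μ ∂μ) (𝓝[>] 0)
      (𝓝 (c.sum fun x a => c.sum fun y b => a * b * K x y)) :=
    tendsto_finsetSum _ fun x _ => tendsto_finsetSum _ fun y _ =>
      (tendsto_average_ball hKc x y).const_mul _
  refine ge_of_tendsto' hlim fun r => ?_
  have h := hpos.inner_nonneg_left
    (∑ x ∈ c.support, c x • averagingLp μ (Metric.isOpen_ball (x := x) (ε := r)).measurableSet)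
  refine h.trans_eq ?_
  simp only [map_sum, map_smul, sum_inner, inner_sum, real_inner_smul_left,
    real_inner_smul_right, inner_integralOperator_averagingLp, Finsupp.sum]
  refine Finset.sum_congr rfl fun x _ => Finset.sum_congr rfl fun y _ => ?_
  ring

end IntegralOperator

theorem isOpenPosMeasure_of_support_eq_univ {X : Type*} [TopologicalSpace X] [MeasurableSpace X]
    {μ : Measure X} (h : μ.support = Set.univ) :
    μ.IsOpenPosMeasure := by
  refine ⟨fun U hU ⟨x, hx⟩ => ?_⟩
  have hxs : x ∈ μ.support := h ▸ Set.mem_univ x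
  exact (((Measure.mem_support_iff_forall x).mp hxs) U (hU.mem_nhds hx)).ne'

/-! ### The doubly centered kernel -/

section MDS

variable {X : Type*} [MetricSpace X]

theorem kernelA_comm (x s : X) : kernelA x s = kernelA s x := by
  rw [kernelA, kernelA, dist_comm]

theorem kernelA_self (x : X) : kernelA x x = 0 := by
  simp [kernelA]

theorem kernelA_eq_of_isometry {H : Type*} [NormedAddCommGroup H] [InnerProductSpace ℝ H]
    {f : X → H} (hf : Isometry f) (x s : X) :
    kernelA x s = ⟪f x, f s⟫ - ‖f x‖ ^ 2 / 2 - ‖f s‖ ^ 2 / 2 := by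
  rw [kernelA, ← hf.dist_eq, dist_eq_norm, norm_sub_sq_real]
  ring

variable [MeasurableSpace X]

theorem kernelB_comm (μ : Measure X) (x s : X) : kernelB μ x s = kernelB μ s x := by
  simp only [kernelB]
  simp_rw [kernelA_comm x s, kernelA_comm x, kernelA_comm _ s]
  ring

/-- Double centering does not change the induced squared distance. -/
theorem kernelB_self_add_self_sub (μ : Measure X) (x s : X) :
    kernelB μ x x - 2 * kernelB μ x s + kernelB μ s s = dist x s ^ 2 := by
  simp only [kernelB, kernelA_self]
  have h : ∀ y, ∫ w, kernelA w y ∂μ = ∫ z, kernelA y z ∂μ := fun y => by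
    simp_rw [kernelA_comm y]
  rw [h, h, kernelA]
  ring

variable [CompactSpace X] [BorelSpace X]

/-- Double centering turns `-d² / 2` into the Gram kernel of the embedding centred at its mean. -/
theorem kernelB_eq_inner_of_isometry (μ : Measure X) [IsProbabilityMeasure μ]
    {H : Type*} [NormedAddCommGroup H] [InnerProductSpace ℝ H] [CompleteSpace H]
    {f : X → H} (hf : Isometry f) (x s : X) :
    kernelB μ x s = ⟪f x - ∫ w, f w ∂μ, f s - ∫ w, f w ∂μ⟫ := by
  have hint : Integrable f μ :=
    hf.continuous.integrable_of_hasCompactSupport (HasCompactSupport.of_compactSpace _)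
  have hsq : Integrable (fun w => ‖f w‖ ^ 2 / 2) μ :=
    Continuous.integrable_of_hasCompactSupport (by have := hf.continuous; fun_prop)
      (HasCompactSupport.of_compactSpace _)
  have hrow : ∀ y, ∫ z, kernelA y z ∂μ =
      ⟪f y, ∫ w, f w ∂μ⟫ - ‖f y‖ ^ 2 / 2 - ∫ w, ‖f w‖ ^ 2 / 2 ∂μ := by
    intro y
    simp_rw [kernelA_eq_of_isometry hf]
    have h : Integrable (fun z => ⟪f y, f z⟫) μ := hint.const_inner _
    have h' : Integrable (fun z => ⟪f y, f z⟫ - ‖f y‖ ^ 2 / 2) μ := h.sub (integrable_const _)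
    rw [integral_sub h' hsq, integral_sub h (integrable_const _), integral_inner hint]
    simp
  have hcol : ∀ y, ∫ w, kernelA w y ∂μ =
      ⟪f y, ∫ w, f w ∂μ⟫ - ‖f y‖ ^ 2 / 2 - ∫ w, ‖f w‖ ^ 2 / 2 ∂μ := by
    intro y
    rw [← hrow]
    simp_rw [kernelA_comm y]
  have htot : ∫ z, ∫ w, kernelA w z ∂μ ∂μ =
      ⟪∫ w, f w ∂μ, ∫ w, f w ∂μ⟫ - 2 * ∫ w, ‖f w‖ ^ 2 / 2 ∂μ := by
    simp_rw [hcol, real_inner_comm (∫ w, f w ∂μ)]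
    have h : Integrable (fun z => ⟪∫ w, f w ∂μ, f z⟫) μ := hint.const_inner _
    have h' : Integrable (fun z => ⟪∫ w, f w ∂μ, f z⟫ - ‖f z‖ ^ 2 / 2) μ := h.sub hsq
    rw [integral_sub h' (integrable_const _), integral_sub h hsq, integral_inner hint]
    simp
    ring
  rw [kernelB, hrow, hcol, htot, kernelA_eq_of_isometry hf, inner_sub_left, inner_sub_right,
    inner_sub_right, real_inner_comm (∫ w, f w ∂μ) (f s)]
  ring

theorem IsEuclidean.isPositive_operatorTB {μ : Measure X} [IsProbabilityMeasure μ]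
    (hX : IsEuclidean X) : (operatorTB μ).IsPositive := by
  obtain ⟨f, hf⟩ := hX
  have hc : Continuous fun x => f x - ∫ w, f w ∂μ := hf.continuous.sub continuous_const
  exact isPositive_integralOperator_of_inner _
    (hc.memLp_of_hasCompactSupport (HasCompactSupport.of_compactSpace _))
    (kernelB_eq_inner_of_isometry μ hf)

theorem isEuclidean_of_isPositive_operatorTB {μ : Measure X} [IsFiniteMeasure μ]
    [μ.IsOpenPosMeasure] (hT : (operatorTB μ).IsPositive) : IsEuclidean X := by
  obtain ⟨H, _, _, _, F, hF⟩ := exists_featureMap (kernelB μ) (kernelB_comm μ)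
    (sum_kernel_nonneg_of_isPositive _ (continuous_kernelB μ) hT)
  refine IsEuclidean.of_isometry (f := F) (Isometry.of_dist_eq fun x y => ?_)
  rw [← sq_eq_sq₀ dist_nonneg dist_nonneg, dist_eq_norm, norm_sub_sq_real,
    ← real_inner_self_eq_norm_sq, ← real_inner_self_eq_norm_sq, hF, hF, hF,
    kernelB_self_add_self_sub]

end MDS

end InfiniteMDS

end

theorem mainTheorem2 {X : Type*} [MetricSpace X] [CompactSpace X] [MeasurableSpace X]
    [BorelSpace X] (μ : MeasureTheory.Measure X) [MeasureTheory.IsProbabilityMeasure μ] :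
    (InfiniteMDS.IsEuclidean X → (InfiniteMDS.operatorTB μ).IsPositive) ∧
      (μ.support = Set.univ →
        (InfiniteMDS.IsEuclidean X ↔ (InfiniteMDS.operatorTB μ).IsPositive)) := by
  refine ⟨fun hX => hX.isPositive_operatorTB, fun hμ => ?_⟩
  have := InfiniteMDS.isOpenPosMeasure_of_support_eq_univ hμ
  exact ⟨fun hX => hX.isPositive_operatorTB, InfiniteMDS.isEuclidean_of_isPositive_operatorTB⟩
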